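/- Let $n\ge 2$ and let $M$ be a non-empty compact smooth $n$-manifold without boundary, smoothly embedded in $\mathbb{R}^{n+1}$ by $F_0:M\hookrightarrow\mathbb{R}^{n+1}$; put $M_0=F_0(M)$. A smooth solution of the mean curvature flow on $[0,T)$ starting from $F_0$ is a smooth map $F:[0,T)\times M\to\mathbb{R}^{n+1}$ such that every $F(t,\cdot)$ is an immersion and $$\partial_t F(t,x)=-H_\nu(t,x)\,\nu(t,x),\qquad F(0,x)=F_0(x),$$ where $\nu(t,x)$ is a unit normal of $F(t,\cdot)$ at $x$ and $H_\nu=\operatorname{trace} S_\nu$ is the trace, with respect to the metric induced by $F(t,\cdot)$, of the second fundamental form $S_\nu(X,Y)=\langle D_X\nu,Y\rangle$ (the vector $H_\nu\nu$ does not depend on the choice of $\nu$ or $-\nu$; one may take the outer normal). Let the explosion time $T_c\in[0,\infty]$ be the supremum of all $T>0$ for which a smooth solution on $[0,T)$ starting from $F_0$ exists. Then $$T_c\le\frac{\operatorname{diam}(M_0)^2}{2n},$$ where $\operatorname{diam}(M_0)$ is the diameter of $M_0$ in the Euclidean distance of $\mathbb{R}^{n+1}$. -/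

import Mathlib

open scoped Manifold ContDiff ENNReal

noncomputable section

namespace MeanCurvatureFlow

section Hypersurface

variable {n : ℕ} {M : Type*} [TopologicalSpace M] [ChartedSpace (EuclideanSpace ℝ (Fin n)) M]

/-- The expression of `f : M → ℝⁿ⁺¹` in the preferred chart of `M` around `x`. -/
def inChart (f : M → EuclideanSpace ℝ (Fin (n + 1))) (x : M) :
    EuclideanSpace ℝ (Fin n) → EuclideanSpace ℝ (Fin (n + 1)) :=
  f ∘ (extChartAt (𝓡 n) x).symm

/-- The first partial derivative `∂ᵢ f` at `x`, in the preferred chart around `x`. -/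
def partialDeriv (f : M → EuclideanSpace ℝ (Fin (n + 1))) (x : M) (i : Fin n) :
    EuclideanSpace ℝ (Fin (n + 1)) :=
  fderiv ℝ (inChart f x) (extChartAt (𝓡 n) x x) (EuclideanSpace.single i 1)

/-- The second partial derivative `∂ᵢ∂ⱼ f` at `x`, in the preferred chart around `x`. -/
def secondPartialDeriv (f : M → EuclideanSpace ℝ (Fin (n + 1))) (x : M) (i j : Fin n) :
    EuclideanSpace ℝ (Fin (n + 1)) :=
  fderiv ℝ (fun y => fderiv ℝ (inChart f x) y (EuclideanSpace.single j 1))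
    (extChartAt (𝓡 n) x x) (EuclideanSpace.single i 1)

/-- The metric on `M` induced by the immersion `f`: its Gram matrix
`gᵢⱼ = ⟪∂ᵢ f, ∂ⱼ f⟫` at `x` in the preferred chart around `x`. -/
def inducedMetric (f : M → EuclideanSpace ℝ (Fin (n + 1))) (x : M) :
    Matrix (Fin n) (Fin n) ℝ :=
  Matrix.of fun i j => inner ℝ (partialDeriv f x i) (partialDeriv f x j)

/-- `ν` is a unit normal vector at `f x` to the immersed hypersurface `f : M → ℝⁿ⁺¹`. -/
def IsUnitNormal (f : M → EuclideanSpace ℝ (Fin (n + 1))) (x : M)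
    (ν : EuclideanSpace ℝ (Fin (n + 1))) : Prop :=
  ‖ν‖ = 1 ∧ ∀ i, inner ℝ ν (partialDeriv f x i) = 0

/-- The second fundamental form `S_ν(X, Y) = ⟪D_X ν, Y⟫ = -⟪ν, D_X Y⟫` of the immersed hypersurface
`f` at `x` in the direction of the unit normal `ν`: its matrix in the preferred chart around `x`.
With this sign a round sphere has positive second fundamental form in the direction of its outer
normal. -/
def secondFundamentalForm (f : M → EuclideanSpace ℝ (Fin (n + 1))) (x : M)
    (ν : EuclideanSpace ℝ (Fin (n + 1))) : Matrix (Fin n) (Fin n) ℝ :=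
  Matrix.of fun i j => -inner ℝ ν (secondPartialDeriv f x i j)

/-- The mean curvature `H_ν = trace S_ν`, the trace of the second fundamental form with respect to
the induced metric, i.e. `∑ᵢⱼ gⁱʲ (S_ν)ᵢⱼ`. -/
def meanCurvature (f : M → EuclideanSpace ℝ (Fin (n + 1))) (x : M)
    (ν : EuclideanSpace ℝ (Fin (n + 1))) : ℝ :=
  ((inducedMetric f x)⁻¹ * secondFundamentalForm f x ν).trace

/-- The vector `H_ν ν` does not depend on which of the two unit normals `ν`, `-ν` is used. -/
theorem meanCurvature_neg_smul_neg (f : M → EuclideanSpace ℝ (Fin (n + 1))) (x : M)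
    (ν : EuclideanSpace ℝ (Fin (n + 1))) :
    meanCurvature f x (-ν) • (-ν) = meanCurvature f x ν • ν := by
  have h : secondFundamentalForm f x (-ν) = -secondFundamentalForm f x ν := by
    ext i j
    simp [secondFundamentalForm]
  simp [meanCurvature, h]

/-- `F` is a smooth solution on `[0, T) × M` of the mean curvature flow
`∂ₜ F = -H_ν ν`, `F(0, ·) = F₀`, through immersions `F(t, ·) : M → ℝⁿ⁺¹`. Since `H_ν ν` is the same
for both unit normals, it is not necessary to single out the outer one. At `t = 0` the time
derivative is the right derivative. Values of `F t` for `t ∉ [0, T)` are irrelevant. -/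
structure IsSolution (F₀ : M → EuclideanSpace ℝ (Fin (n + 1))) (T : ℝ)
    (F : ℝ → M → EuclideanSpace ℝ (Fin (n + 1))) : Prop where
  smooth : ContMDiffOn (𝓘(ℝ, ℝ).prod (𝓡 n)) (𝓡 (n + 1)) ∞
    (fun p : ℝ × M => F p.1 p.2) (Set.Ico 0 T ×ˢ Set.univ)
  immersion : ∀ t ∈ Set.Ico 0 T, ∀ x,
    Function.Injective (mfderiv (𝓡 n) (𝓡 (n + 1)) (F t) x)
  evolution : ∀ t ∈ Set.Ico 0 T, ∀ x, ∃ ν, IsUnitNormal (F t) x ν ∧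
    HasDerivWithinAt (fun s => F s x) (-(meanCurvature (F t) x ν • ν)) (Set.Ici 0) t
  initial : F 0 = F₀

/-- The explosion time `T_c ∈ [0, ∞]` of the mean curvature flow starting from `F₀`: the supremum
of all times `T > 0` such that there is a smooth solution on `[0, T)`. -/
def explosionTime (F₀ : M → EuclideanSpace ℝ (Fin (n + 1))) : ℝ≥0∞ :=
  ⨆ (T : ℝ) (_ : 0 < T ∧ ∃ F, IsSolution F₀ T F), ENNReal.ofReal T

end Hypersurface

end MeanCurvatureFlow

end

/-!
The enclosing-ball argument: as the flow moves, the squared distance to a fixed point `p` obeys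
`(∂ₜ - Δ) |F - p|² = -2n`, so by the maximum principle `max |F(t, ·) - p|² + 2nt` does not increase.
Taking `p ∈ M₀`, the initial maximum is at most `diam(M₀)²`, whence `2nt ≤ diam(M₀)²` for every time
`t` at which the flow exists.

The maximum principle needs no Laplacian, only its sign at a maximum
(`MeanCurvatureFlow.le_inner_sub_meanCurvature_smul`). Where `|f - p|²` has a local maximum on an
immersed hypersurface `f`, the first-order condition says that `f - p = c ν` is normal, and the
second-order condition says that `g - c S_ν ≤ 0` as a quadratic form. Tracing against the positive
definite `g⁻¹` gives `n ≤ c H_ν = ⟪f - p, H_ν ν⟫`. Hence `|F - p|² + (2n - ε) t` has time derivative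
at most `-ε` at a spatial maximum, and its maximum over `[0, t] × M` can only be attained at time
`0` (`MeanCurvatureFlow.IsSolution.norm_sub_sq_add_le`).
-/

/-! ### A trace inequality for matrices -/

open scoped MatrixOrder Matrix.Norms.L2Operator in
/-- The trace of a product of a positive and a negative semidefinite matrix is nonpositive. The
matrix `Q` of the quadratic form is not assumed to be symmetric. -/
theorem Matrix.PosSemidef.trace_mul_nonpos {ι : Type*} [Fintype ι] {P Q : Matrix ι ι ℝ}
    (hP : P.PosSemidef) (hQ : ∀ v : ι → ℝ, v ⬝ᵥ Q.mulVec v ≤ 0) : (P * Q).trace ≤ 0 := by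
  classical
  obtain ⟨B, rfl⟩ := CStarAlgebra.nonneg_iff_eq_star_mul_self.mp hP.nonneg
  -- With `P = Bᴴ B`, the trace is the sum of the values of `Q` on the rows of `B`.
  rw [Matrix.mul_assoc, Matrix.trace_mul_comm]
  refine Finset.sum_nonpos fun i _ => ?_
  have h := hQ (B i)
  simpa [Matrix.mul_assoc, Matrix.mul_apply, dotProduct, Matrix.mulVec, Matrix.diag,
    Matrix.star_apply, Finset.mul_sum, Finset.sum_mul, mul_assoc,
    Finset.sum_comm (f := fun j k => B i k * (Q k j * B i j))] using h

/-! ### First and second derivatives at a maximum -/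

section SquaredDistance

variable {E F : Type*} [NormedAddCommGroup E] [NormedSpace ℝ E] [NormedAddCommGroup F]
  [InnerProductSpace ℝ F]

theorem IsLocalMax.inner_fderiv_eq_zero {G : E → F} {y : E} {p : F}
    (hG : DifferentiableAt ℝ G y) (h : IsLocalMax (fun z => ‖G z - p‖ ^ 2) y) (v : E) :
    inner ℝ (G y - p) (fderiv ℝ G y v) = 0 := by
  have h1 := (hG.hasFDerivAt.sub_const p).norm_sq
  have h2 := congrArg (fun l => l v) (h.hasFDerivAt_eq_zero h1)
  simpa [inner_sub_left] using h2

/-- The second-order necessary condition at a local maximum of the squared distance to `p`. -/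
theorem IsLocalMax.inner_fderiv_fderiv_add_norm_sq_nonpos {G : E → F} {y : E} {p : F}
    (hG : ContDiffAt ℝ 2 G y) (h : IsLocalMax (fun z => ‖G z - p‖ ^ 2) y) (v : E) :
    inner ℝ (G y - p) (fderiv ℝ (fderiv ℝ G) y v v) + ‖fderiv ℝ G y v‖ ^ 2 ≤ 0 := by
  -- Otherwise the restriction of the squared distance to the line through `y` in the direction `v`
  -- has positive second derivative, hence also a local minimum,
  -- at `0`: it is locally constant, and its second derivative vanishes after all.
  by_contra! hpos
  set l : ℝ → E := fun s => y + s • v with hl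
  have hl0 : l 0 = y := by simp [hl]
  have hl' : ∀ s, HasDerivAt l v s := fun s => by
    simpa [hl] using ((hasDerivAt_id s).smul_const v).const_add y
  have hlc : Filter.Tendsto l (nhds 0) (nhds y) := by
    simpa [hl0] using (hl' 0).continuousAt.tendsto
  set f : ℝ → ℝ := fun s => ‖G (l s) - p‖ ^ 2 with hf
  have hmax : IsLocalMax f 0 := by
    have := hlc.eventually h
    filter_upwards [this] with s hs
    simpa [hf, hl0] using hs
  have hd : ∀ᶠ s in nhds 0, HasDerivAt f (2 * inner ℝ (G (l s) - p) (fderiv ℝ G (l s) v)) s := by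
    have h1 : ∀ᶠ z in nhds y, DifferentiableAt ℝ G z :=
      (hG.eventually (by simp)).mono fun z hz => hz.differentiableAt (by simp)
    filter_upwards [hlc.eventually h1] with s hs
    exact ((hs.hasFDerivAt.comp_hasDerivAt s (hl' s)).sub_const p).norm_sq
  have hG' : DifferentiableAt ℝ (fderiv ℝ G) y :=
    (hG.fderiv_right (m := 1) (by norm_num)).differentiableAt (by simp)
  have hdd : deriv (deriv f) 0 =
      2 * (inner ℝ (G y - p) (fderiv ℝ (fderiv ℝ G) y v v) + ‖fderiv ℝ G y v‖ ^ 2) := by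
    have h1 : deriv f =ᶠ[nhds 0] fun s => 2 * inner ℝ (G (l s) - p) (fderiv ℝ G (l s) v) :=
      hd.mono fun s hs => hs.deriv
    rw [h1.deriv_eq]
    have hGl : HasDerivAt (fun s => G (l s) - p) (fderiv ℝ G y v) 0 := by
      have := (hG.differentiableAt (by simp)).hasFDerivAt
      rw [← hl0] at this
      simpa [hl0] using (this.comp_hasDerivAt 0 (hl' 0)).sub_const p
    have hGl' : HasDerivAt (fun s => fderiv ℝ G (l s) v) (fderiv ℝ (fderiv ℝ G) y v v) 0 := by
      have := hG'.hasFDerivAt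
      rw [← hl0] at this
      simpa [hl0] using (this.comp_hasDerivAt 0 (hl' 0)).clm_apply (hasDerivAt_const 0 v)
    rw [((hGl.inner ℝ hGl').const_mul 2).deriv]
    simp [hl0]
  have hmin : IsLocalMin f 0 :=
    isLocalMin_of_deriv_deriv_pos (by rw [hdd]; linarith) hmax.deriv_eq_zero
      hd.self_of_nhds.continuousAt
  have hconst : f =ᶠ[nhds 0] fun _ => f 0 := by
    filter_upwards [hmax, hmin] with s h1 h2 using le_antisymm h1 h2
  have h0 : deriv (deriv f) 0 = 0 := by
    rw [hconst.deriv.deriv_eq]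
    simp
  rw [hdd] at h0
  linarith

end SquaredDistance

theorem HasDerivAt.nonneg_of_isMaxOn_Icc {f : ℝ → ℝ} {f' a b : ℝ} (hab : a < b)
    (hf : HasDerivAt f f' b) (h : ∀ s ∈ Set.Icc a b, f s ≤ f b) : 0 ≤ f' := by
  -- The slopes from the left are nonnegative.
  have h1 := (hasDerivWithinAt_iff_tendsto_slope' (s := Set.Iio b) (by simp)).mp
    hf.hasDerivWithinAt
  refine ge_of_tendsto h1 ?_
  filter_upwards [Ioo_mem_nhdsLT hab] with s hs
  rw [slope_def_field]
  exact div_nonneg_of_nonpos (by linarith [h s ⟨hs.1.le, hs.2.le⟩]) (by linarith [hs.2])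

/-! ### Immersed hypersurfaces in the preferred chart -/

/-- In dimension `n + 1`, the normal line of `n` independent vectors is spanned by any of its nonzero
elements. -/
theorem exists_eq_smul_of_orthogonal {n : ℕ} {F : Type*} [NormedAddCommGroup F]
    [InnerProductSpace ℝ F] [FiniteDimensional ℝ F] (hF : Module.finrank ℝ F = n + 1)
    {e : Fin n → F} (he : LinearIndependent ℝ e)
    {ν w : F} (hν0 : ν ≠ 0) (hν : ∀ i, inner ℝ ν (e i) = 0) (hw : ∀ i, inner ℝ w (e i) = 0) :
    ∃ c : ℝ, w = c • ν := by
  have mem : ∀ u : F, (∀ i, inner ℝ u (e i) = 0) → u ∈ (Submodule.span ℝ (Set.range e))ᗮ := by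
    intro u hu
    rw [← Submodule.span_singleton_le_iff_mem, Submodule.le_orthogonal_iff_le_orthogonal,
      Submodule.span_le]
    rintro _ ⟨i, rfl⟩
    rw [SetLike.mem_coe, Submodule.mem_orthogonal_singleton_iff_inner_right]
    exact hu i
  have h1 := (Submodule.span ℝ (Set.range e)).finrank_add_finrank_orthogonal
  rw [finrank_span_eq_card he, Fintype.card_fin, hF] at h1
  have h2 : Module.finrank ℝ (Submodule.span ℝ (Set.range e))ᗮ = 1 := Nat.add_left_cancel h1
  obtain ⟨c, hc⟩ := (finrank_eq_one_iff_of_nonzero'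
    (⟨ν, mem ν hν⟩ : (Submodule.span ℝ (Set.range e))ᗮ) (by simpa using hν0)).mp h2 ⟨w, mem w hw⟩
  exact ⟨c, by simpa using (congrArg Subtype.val hc).symm⟩

namespace MeanCurvatureFlow

variable {n : ℕ} {M : Type*} [TopologicalSpace M] [ChartedSpace (EuclideanSpace ℝ (Fin n)) M]
  {f : M → EuclideanSpace ℝ (Fin (n + 1))} {x : M}

theorem contDiffAt_inChart (hf : ContMDiffAt (𝓡 n) (𝓡 (n + 1)) ∞ f x) :
    ContDiffAt ℝ ∞ (inChart f x) (extChartAt (𝓡 n) x x) := by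
  have h := (contMDiffAt_iff.mp hf).2
  simpa [contDiffWithinAt_univ] using! h

theorem fderiv_inChart_injective (hf : ContMDiffAt (𝓡 n) (𝓡 (n + 1)) ∞ f x)
    (h : Function.Injective (mfderiv (𝓡 n) (𝓡 (n + 1)) f x)) :
    Function.Injective (fderiv ℝ (inChart f x) (extChartAt (𝓡 n) x x)) := by
  have h1 : mfderiv (𝓡 n) (𝓡 (n + 1)) f x = fderiv ℝ (inChart f x) (extChartAt (𝓡 n) x x) := by
    rw [(hf.mdifferentiableAt (by simp)).mfderiv]
    simp [writtenInExtChartAt, inChart]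
    rfl
  rwa [h1] at h

theorem linearIndependent_partialDeriv
    (h : Function.Injective (fderiv ℝ (inChart f x) (extChartAt (𝓡 n) x x))) :
    LinearIndependent ℝ (partialDeriv f x) := by
  have h1 := (EuclideanSpace.basisFun (Fin n) ℝ).toBasis.linearIndependent.map'
    (fderiv ℝ (inChart f x) (extChartAt (𝓡 n) x x)).toLinearMap (LinearMap.ker_eq_bot.mpr h)
  have h2 : partialDeriv f x = (fderiv ℝ (inChart f x) (extChartAt (𝓡 n) x x)).toLinearMap ∘
      (EuclideanSpace.basisFun (Fin n) ℝ).toBasis := by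
    ext1 i
    simp [partialDeriv]
  rw [h2]
  exact h1

theorem posDef_inducedMetric (h : LinearIndependent ℝ (partialDeriv f x)) :
    (inducedMetric f x).PosDef :=
  Matrix.posDef_gram_of_linearIndependent h

theorem secondPartialDeriv_eq (hf : ContDiffAt ℝ ∞ (inChart f x) (extChartAt (𝓡 n) x x))
    (i j : Fin n) : secondPartialDeriv f x i j =
      fderiv ℝ (fderiv ℝ (inChart f x)) (extChartAt (𝓡 n) x x) (EuclideanSpace.single i 1)
        (EuclideanSpace.single j 1) := by
  have h1 : DifferentiableAt ℝ (fderiv ℝ (inChart f x)) (extChartAt (𝓡 n) x x) :=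
    ((contDiffAt_infty.mp hf 2).fderiv_right (m := 1) (by norm_num)).differentiableAt (by simp)
  rw [secondPartialDeriv, fderiv_clm_apply h1 (differentiableAt_const _)]
  simp

/-- Comparison of mean curvatures with the enclosing sphere: where `f` is locally farthest from `p`,
at distance `r`, its mean curvature in the direction pointing away from `p` is at least `n / r`. -/
theorem le_inner_sub_meanCurvature_smul {p ν : EuclideanSpace ℝ (Fin (n + 1))}
    (hf : ContMDiffAt (𝓡 n) (𝓡 (n + 1)) ∞ f x)
    (himm : Function.Injective (mfderiv (𝓡 n) (𝓡 (n + 1)) f x)) (hν : IsUnitNormal f x ν)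
    (hmax : IsLocalMax (fun y => ‖f y - p‖ ^ 2) x) :
    (n : ℝ) ≤ inner ℝ (f x - p) (meanCurvature f x ν • ν) := by
  set y₀ := extChartAt (𝓡 n) x x with hy₀
  set G := inChart f x with hGdef
  have hG : ContDiffAt ℝ ∞ G y₀ := contDiffAt_inChart hf
  have hinj := fderiv_inChart_injective hf himm
  have hG0 : G y₀ = f x := by simp [hGdef, inChart, hy₀]
  have hmaxG : IsLocalMax (fun z => ‖G z - p‖ ^ 2) y₀ := by
    have hc : Filter.Tendsto (extChartAt (𝓡 n) x).symm (nhds y₀) (nhds x) := by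
      simpa [hy₀] using (continuousAt_extChartAt_symm (I := 𝓡 n) x).tendsto
    filter_upwards [hc.eventually hmax] with z hz
    rw [hG0]
    exact hz
  have hli := linearIndependent_partialDeriv hinj
  have hg := posDef_inducedMetric hli
  obtain ⟨c, hc⟩ := exists_eq_smul_of_orthogonal (by simp) hli (norm_ne_zero_iff.mp
    (by rw [hν.1]; exact one_ne_zero)) hν.2 (w := f x - p) (fun i => by
      rw [← hG0]
      exact hmaxG.inner_fderiv_eq_zero (hG.differentiableAt (by simp)) _)
  -- `⟪f - p, ∂ᵢ∂ⱼ f⟫ = -c (S_ν)ᵢⱼ`, so this is the second-order condition at the maximum.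
  have hquad : ∀ v : Fin n → ℝ,
      v ⬝ᵥ (inducedMetric f x - c • secondFundamentalForm f x ν).mulVec v ≤ 0 := by
    intro v
    have h2 := hmaxG.inner_fderiv_fderiv_add_norm_sq_nonpos (contDiffAt_infty.mp hG 2)
      (WithLp.toLp 2 v)
    have hv : WithLp.toLp 2 v = ∑ i, v i • (EuclideanSpace.single i (1 : ℝ)) := by
      ext j; simp [Finset.sum_apply, Pi.single_apply]
    refine le_of_eq_of_le ?_ h2
    rw [← real_inner_self_eq_norm_sq, hG0, hv]
    simp only [map_sum, map_smul, sum_apply, smul_apply,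
      inner_sum, sum_inner, inner_smul_left, inner_smul_right, dotProduct, Matrix.mulVec,
      Matrix.sub_apply, Matrix.smul_apply, inducedMetric, secondFundamentalForm, Matrix.of_apply,
      secondPartialDeriv_eq hG, hc, Finset.mul_sum, ← Finset.sum_add_distrib]
    rw [Finset.sum_comm]
    refine Finset.sum_congr rfl fun j _ => Finset.sum_congr rfl fun i _ => ?_
    simp only [partialDeriv, conj_trivial, smul_eq_mul, ← hGdef, ← hy₀]
    ring
  have htr := hg.inv.posSemidef.trace_mul_nonpos hquad
  have hdet := (Matrix.isUnit_iff_isUnit_det _).mp hg.isUnit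
  rw [Matrix.mul_sub, Matrix.nonsing_inv_mul _ hdet, Matrix.trace_sub, Matrix.mul_smul,
    Matrix.trace_smul, Matrix.trace_one, Fintype.card_fin] at htr
  rw [hc, inner_smul_left, inner_smul_right, real_inner_self_eq_norm_sq, hν.1]
  simp only [meanCurvature]
  simp at htr ⊢
  linarith

/-! ### The maximum principle along the flow -/

theorem IsSolution.contMDiff {F₀ : M → EuclideanSpace ℝ (Fin (n + 1))} {T : ℝ}
    {F : ℝ → M → EuclideanSpace ℝ (Fin (n + 1))} (h : IsSolution F₀ T F) {t : ℝ}
    (ht : t ∈ Set.Ico 0 T) : ContMDiff (𝓡 n) (𝓡 (n + 1)) ∞ (F t) := by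
  have h1 : ContMDiff (𝓡 n) (𝓘(ℝ, ℝ).prod (𝓡 n)) ∞ (fun x : M => (t, x)) :=
    contMDiff_const.prodMk contMDiff_id
  exact contMDiffOn_univ.mp
    (h.smooth.comp (h1.contMDiffOn (s := Set.univ)) fun x _ => ⟨ht, trivial⟩)

/-- Comparison with shrinking spheres: if `M₀` lies in the ball of squared radius `D` around `p`, then
at time `t` the hypersurface lies in the ball of squared radius `D - 2nt` around `p`. -/
theorem IsSolution.norm_sub_sq_add_le [CompactSpace M] {F₀ : M → EuclideanSpace ℝ (Fin (n + 1))}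
    {T : ℝ} {F : ℝ → M → EuclideanSpace ℝ (Fin (n + 1))} (h : IsSolution F₀ T F)
    {p : EuclideanSpace ℝ (Fin (n + 1))} {D : ℝ} (hD : ∀ x, ‖F₀ x - p‖ ^ 2 ≤ D) {t : ℝ}
    (ht : t ∈ Set.Ico 0 T) (x : M) : ‖F t x - p‖ ^ 2 + 2 * n * t ≤ D := by
  -- The loss of `ε` makes the time derivative strictly negative at a spatial maximum.
  suffices H : ∀ ε > 0, ‖F t x - p‖ ^ 2 + (2 * n - ε) * t ≤ D by
    have hlim : Filter.Tendsto (fun ε : ℝ => ‖F t x - p‖ ^ 2 + (2 * n - ε) * t)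
        (nhdsWithin 0 (Set.Ioi 0)) (nhds (‖F t x - p‖ ^ 2 + (2 * n - 0) * t)) :=
      (Continuous.tendsto (by fun_prop) 0).mono_left nhdsWithin_le_nhds
    rw [sub_zero] at hlim
    exact le_of_tendsto hlim (Filter.eventually_of_mem self_mem_nhdsWithin H)
  intro ε hε
  have hsub : Set.Icc 0 t ×ˢ (Set.univ : Set M) ⊆ Set.Ico 0 T ×ˢ Set.univ :=
    Set.prod_mono (fun s hs => ⟨hs.1, hs.2.trans_lt ht.2⟩) le_rfl
  have hcont : ContinuousOn (fun q : ℝ × M => ‖F q.1 q.2 - p‖ ^ 2 + (2 * n - ε) * q.1)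
      (Set.Icc 0 t ×ˢ Set.univ) := by
    have := h.smooth.continuousOn.mono hsub
    fun_prop
  obtain ⟨⟨s, z⟩, ⟨hs, -⟩, hmax⟩ := (isCompact_Icc.prod isCompact_univ).exists_isMaxOn
    ⟨(t, x), ⟨⟨ht.1, le_rfl⟩, trivial⟩⟩ hcont
  have hmax' : ∀ r ∈ Set.Icc 0 t, ∀ y, ‖F r y - p‖ ^ 2 + (2 * n - ε) * r ≤
      ‖F s z - p‖ ^ 2 + (2 * n - ε) * s := fun r hr y => hmax (a := (r, y)) ⟨hr, trivial⟩
  refine (hmax' t ⟨ht.1, le_rfl⟩ x).trans ?_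
  rcases hs.1.eq_or_lt with rfl | hs0
  · simpa [h.initial] using hD z
  exfalso
  have hsT : s ∈ Set.Ico 0 T := ⟨hs.1, hs.2.trans_lt ht.2⟩
  obtain ⟨ν, hν, hderiv⟩ := h.evolution s hsT z
  have hH := le_inner_sub_meanCurvature_smul (p := p) (h.contMDiff hsT z) (h.immersion s hsT z) hν
    (Filter.Eventually.of_forall fun y => by linarith [hmax' s hs y])
  have hd := ((hderiv.hasDerivAt (Ici_mem_nhds hs0)).sub_const p).norm_sq.add
    ((hasDerivAt_id s).const_mul (2 * n - ε))
  have := hd.nonneg_of_isMaxOn_Icc hs0 fun r hr => hmax' r ⟨hr.1, hr.2.trans hs.2⟩ z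
  rw [inner_neg_right] at this
  linarith

theorem IsSolution.le_diam_sq_div [CompactSpace M] [Nonempty M] (hn : 0 < n)
    {F₀ : M → EuclideanSpace ℝ (Fin (n + 1))} {T : ℝ}
    {F : ℝ → M → EuclideanSpace ℝ (Fin (n + 1))} (hT : 0 < T) (h : IsSolution F₀ T F) :
    T ≤ Metric.diam (Set.range F₀) ^ 2 / (2 * n) := by
  obtain ⟨x₀⟩ := ‹Nonempty M›
  have hc : Continuous F₀ := h.initial ▸ (h.contMDiff ⟨le_rfl, hT⟩).continuous
  have hD : ∀ x, ‖F₀ x - F₀ x₀‖ ^ 2 ≤ Metric.diam (Set.range F₀) ^ 2 := fun x => by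
    rw [← dist_eq_norm]
    gcongr
    exact Metric.dist_le_diam_of_mem (isCompact_range hc).isBounded ⟨x, rfl⟩ ⟨x₀, rfl⟩
  -- There is no value of the flow at time `T`, so the bound is applied at the times `t < T`.
  refine le_of_forall_lt_imp_le_of_dense fun t ht => ?_
  have hn' : (0 : ℝ) < 2 * n := by positivity
  rw [le_div_iff₀ hn']
  rcases lt_or_ge t 0 with h0 | h0
  · nlinarith [sq_nonneg (Metric.diam (Set.range F₀))]
  · nlinarith [h.norm_sub_sq_add_le hD ⟨h0, ht⟩ x₀, sq_nonneg ‖F t x₀ - F₀ x₀‖]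

end MeanCurvatureFlow

theorem mainTheorem7 {n : ℕ} (hn : 2 ≤ n) {M : Type*} [TopologicalSpace M] [CompactSpace M]
    [Nonempty M] [ChartedSpace (EuclideanSpace ℝ (Fin n)) M] [IsManifold (𝓡 n) ∞ M]
    (F₀ : M → EuclideanSpace ℝ (Fin (n + 1)))
    (hF₀ : Manifold.IsSmoothEmbedding (𝓡 n) (𝓡 (n + 1)) ∞ F₀) :
    MeanCurvatureFlow.explosionTime F₀ ≤ ENNReal.ofReal (Metric.diam (Set.range F₀) ^ 2 / (2 * n)) := by
  refine iSup₂_le fun T hT => ?_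
  obtain ⟨hT0, F, hF⟩ := hT
  exact ENNReal.ofReal_le_ofReal (hF.le_diam_sq_div (by omega) hT0)
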